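/- Let $R$ be a commutative ring with $1$, let $m\ge 1$ and $r\ge 0$ be integers, and let $q,q^{-1},u_1,\dots,u_m\in R$. Let $\mathbf H=\mathbf H_m^r$ be the Ariki–Koike algebra: the associative unital $R$-algebra with generators $T_0,T_1,\dots,T_{r-1}$ and relations $T_0T_1T_0T_1=T_1T_0T_1T_0$; $T_iT_{i+1}T_i=T_{i+1}T_iT_{i+1}$ for $1\le i\le r-2$; $T_iT_j=T_jT_i$ for $|i-j|\ge 2$; $(T_i-q)(T_i+1)=0$ for $i\ne 0$; and $(T_0-u_1)\cdots(T_0-u_m)=0$ (each relation being imposed when the generators in it exist). Let $\mathcal H$ be the subalgebra of $\mathbf H$ generated by the $T_i$ with $i\ge 1$. Put $L_1=T_0$ and $L_i=q^{-1}T_{i-1}L_{i-1}T_{i-1}$ for $2\le i\le r$, and for $x\in R$ and $0\le c\le r$ put $\pi_c(x)=\prod_{j=1}^{c}(L_j-x)$, so that $\pi_0(x)=1$. Let $\Lambda[m,r]$ be the set of integer sequences $\mathbf a=[a_0,a_1,\dots,a_m]$ with $0=a_0\le a_1\le\dots\le a_m=r$, partially ordered by $\mathbf a\preccurlyeq\mathbf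 b$ if and only if $a_i\le b_i$ for all $i$. For $\mathbf a\in\Lambda[m,r]$ put $\mathbf a'=[0,r-a_{m-1},\dots,r-a_1,r]\in\Lambda[m,r]$ and $$\pi_{\mathbf a}=\pi_{a_1}(u_2)\pi_{a_2}(u_3)\cdots\pi_{a_{m-1}}(u_m),\qquad \tilde\pi_{\mathbf a}=\pi_{a_1}(u_{m-1})\pi_{a_2}(u_{m-2})\cdots\pi_{a_{m-1}}(u_1).$$ **Lemma.** For all $\mathbf a,\mathbf b\in\Lambda[m,r]$, if $\mathbf a\not\preccurlyeq\mathbf b$, then $\pi_{\mathbf a}\,\mathcal H\,\tilde\pi_{\mathbf b'}=0$ and $\tilde\pi_{\mathbf a}\,\mathcal H\,\pi_{\mathbf b'}=0$; that is, $\pi_{\mathbf a}h\tilde\pi_{\mathbf b'}=0$ and $\tilde\pi_{\mathbf a}h\pi_{\mathbf b'}=0$ for every $h\in\mathcal H$. -/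

import Mathlib

/-- The set `Λ[m, r]` of integer sequences `[a_0, a_1, …, a_m]` with
`0 = a_0 ≤ a_1 ≤ ⋯ ≤ a_m = r`. -/
@[ext]
structure CompChain (m r : ℕ) where
  /-- the entries `a_0, …, a_m` -/
  seq : Fin (m + 1) → ℕ
  seq_zero : seq 0 = 0
  seq_last : seq (Fin.last m) = r
  seq_mono : Monotone seq

namespace CompChain

/-- The partial order `a ≼ b`: `a_i ≤ b_i` for every `i`. -/
instance instPartialOrder (m r : ℕ) : PartialOrder (CompChain m r) :=
  PartialOrder.lift CompChain.seq (fun _ _ h => CompChain.ext h)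

theorem seq_le {m r : ℕ} (a : CompChain m r) (i : Fin (m + 1)) : a.seq i ≤ r := by
  have h := a.seq_mono (Fin.le_last i)
  rwa [a.seq_last] at h

/-- The sequence `a' = [0, r - a_{m-1}, …, r - a_1, r]`, that is `a'_i = r - a_{m-i}`. -/
def dual {m r : ℕ} (a : CompChain m r) : CompChain m r where
  seq i := r - a.seq i.rev
  seq_zero := by simp [a.seq_last]
  seq_last := by simp [a.seq_zero]
  seq_mono := fun _ _ h => Nat.sub_le_sub_left (a.seq_mono (Fin.rev_le_rev.mpr h)) r

end CompChain

/-- The defining relations of the Ariki–Koike algebra, on the free algebra with generators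
`T_0, …, T_{r-1}`. The parameter `u_i`, `1 ≤ i ≤ m`, is the value of `u` at `i - 1`. -/
inductive ArikiKoikeRel {R : Type*} [CommRing R] {m : ℕ} (q : Rˣ) (u : Fin m → R) (r : ℕ) :
    FreeAlgebra R (Fin r) → FreeAlgebra R (Fin r) → Prop
  | quartic (i j : Fin r) (hi : (i : ℕ) = 0) (hj : (j : ℕ) = 1) :
      ArikiKoikeRel q u r
        (FreeAlgebra.ι R i * FreeAlgebra.ι R j * FreeAlgebra.ι R i * FreeAlgebra.ι R j)
        (FreeAlgebra.ι R j * FreeAlgebra.ι R i * FreeAlgebra.ι R j * FreeAlgebra.ι R i)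
  | braid (i j : Fin r) (hi : 1 ≤ (i : ℕ)) (hj : (j : ℕ) = i + 1) :
      ArikiKoikeRel q u r
        (FreeAlgebra.ι R i * FreeAlgebra.ι R j * FreeAlgebra.ι R i)
        (FreeAlgebra.ι R j * FreeAlgebra.ι R i * FreeAlgebra.ι R j)
  | far_comm (i j : Fin r) (hij : (i : ℕ) + 2 ≤ j) :
      ArikiKoikeRel q u r
        (FreeAlgebra.ι R i * FreeAlgebra.ι R j)
        (FreeAlgebra.ι R j * FreeAlgebra.ι R i)
  | quadratic (i : Fin r) (hi : (i : ℕ) ≠ 0) :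
      ArikiKoikeRel q u r
        ((FreeAlgebra.ι R i - algebraMap R _ (q : R)) * (FreeAlgebra.ι R i + 1))
        0
  | cyclotomic (i : Fin r) (hi : (i : ℕ) = 0) :
      ArikiKoikeRel q u r
        (List.ofFn fun k : Fin m => FreeAlgebra.ι R i - algebraMap R _ (u k)).prod
        0

/-- The Ariki–Koike algebra with parameters `q, q⁻¹, u_1, …, u_m ∈ R`: the `R`-algebra with
generators `T_0, …, T_{r-1}` and the relations `ArikiKoikeRel`. -/
abbrev ArikiKoike {R : Type*} [CommRing R] {m : ℕ} (q : Rˣ) (u : Fin m → R) (r : ℕ) : Type _ :=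
  RingQuot (ArikiKoikeRel q u r)

namespace ArikiKoike

variable {R : Type*} [CommRing R] {m : ℕ} (q : Rˣ) (u : Fin m → R) {r : ℕ}

/-- The generator `T_i`, `0 ≤ i ≤ r - 1`. -/
noncomputable def T (i : Fin r) : ArikiKoike q u r :=
  RingQuot.mkAlgHom R (ArikiKoikeRel q u r) (FreeAlgebra.ι R i)

/-- `L q u i hi` is the element `L_{i+1}`: one has `L_1 = T_0` and
`L_{i+2} = q⁻¹ T_{i+1} L_{i+1} T_{i+1}`. -/
noncomputable def L : (i : ℕ) → i < r → ArikiKoike q u r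
  | 0, hi => T q u ⟨0, hi⟩
  | i + 1, hi =>
      ((q⁻¹ : Rˣ) : R) •
        (T q u ⟨i + 1, hi⟩ * L i (Nat.lt_of_succ_lt hi) * T q u ⟨i + 1, hi⟩)

/-- The type `A` Hecke subalgebra, generated by the `T_i` with `i ≥ 1`. -/
def heckeA (r : ℕ) : Subalgebra R (ArikiKoike q u r) :=
  Algebra.adjoin R {t | ∃ i : Fin r, 1 ≤ (i : ℕ) ∧ t = T q u i}

/-- `π_c(x) = (L_1 - x) (L_2 - x) ⋯ (L_c - x)` for `0 ≤ c ≤ r`, so `π_0(x) = 1`. -/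
noncomputable def piFactor (c : ℕ) (hc : c ≤ r) (x : R) : ArikiKoike q u r :=
  (List.ofFn fun j : Fin c =>
    L q u (j : ℕ) (lt_of_lt_of_le j.isLt hc) - algebraMap R (ArikiKoike q u r) x).prod

/-- `π(a; x_1, …, x_{m-1}) = π_{a_1}(x_1) ⋯ π_{a_{m-1}}(x_{m-1})`, where `x_k` is the value of
`x` at `k - 1`. -/
noncomputable def piSeq (a : CompChain m r) (x : Fin (m - 1) → R) : ArikiKoike q u r :=
  (List.ofFn fun k : Fin (m - 1) =>
    piFactor q u (a.seq ⟨(k : ℕ) + 1, by omega⟩) (a.seq_le _) (x k)).prod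

/-- `π_a = π_{a_1}(u_2) ⋯ π_{a_{m-1}}(u_m)`. -/
noncomputable def piElt (a : CompChain m r) : ArikiKoike q u r :=
  piSeq q u a fun k => u ⟨(k : ℕ) + 1, by omega⟩

/-- `π̃_a = π_{a_1}(u_{m-1}) ⋯ π_{a_{m-1}}(u_1)`. -/
noncomputable def piTilde (a : CompChain m r) : ArikiKoike q u r :=
  piSeq q u a fun k => u ⟨m - 2 - (k : ℕ), by omega⟩

end ArikiKoike

/-! If `a ⋠ b`, choose `i` with `b_i < a_i`; then `0 < i < m`. Since the entries of `a` and `b`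
increase, `π_a` is a multiple of `X_c = π_c(u_{i+1}) ⋯ π_c(u_m)` with `c = a_i`, and `π̃_{b'}` is a
multiple of `Y_d = π_d(u_1) ⋯ π_d(u_i)` with `d = r - b_i`. All these factors commute, so it
suffices that `X_c h Y_d = 0` whenever `c + d > r`.

This is proved by induction on `N`, for `h` in the subalgebra generated by `T_1, …, T_{N-1}` and `c,
d ≤ N < c + d`. Two facts carry it: `T_i` commutes with `π_c(x)` for `i ≠ c`
(`commute_map_shiftedProd`), and `X_c Y_d = 0` for `c, d ≥ 1`, because it contains the cyclotomic
product in `L_1 = T_0`. If `c = N` or `d = N`, then `h` moves past `X_c` or `Y_d`. Otherwise the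
coset decomposition (`heckeBelow_succ_le_span`) lowers both `N` and `d` by one.

The second identity is the first for the parameters in reverse order. -/

/-- The relations of the Ariki–Koike algebra other than the cyclotomic one, for a sequence of
elements of an algebra; the quadratic relation is only imposed below `r`. -/
structure AffineHeckeRel {R A : Type*} [CommRing R] [Ring A] [Algebra R A] (q : Rˣ) (r : ℕ)
    (T : ℕ → A) : Prop where
  quartic : T 0 * T 1 * T 0 * T 1 = T 1 * T 0 * T 1 * T 0
  braid (i : ℕ) (hi : 1 ≤ i) : T i * T (i + 1) * T i = T (i + 1) * T i * T (i + 1)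
  far_comm (i j : ℕ) (hij : i + 2 ≤ j) : Commute (T i) (T j)
  quadratic (i : ℕ) (hi : 1 ≤ i) (hr : i < r) :
    T i * T i = ((q : R) - 1) • T i + (q : R) • (1 : A)

/-- The Jucys–Murphy elements `T_0` and `q⁻¹ T_{i+1} L_i T_{i+1}` of a sequence `T`. -/
def jucysMurphy {R A : Type*} [CommRing R] [Ring A] [Algebra R A] (q : Rˣ) (T : ℕ → A) : ℕ → A
  | 0 => T 0
  | i + 1 => ((q⁻¹ : Rˣ) : R) • (T (i + 1) * jucysMurphy q T i * T (i + 1))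

/-- The descending product `T_N T_{N-1} ⋯` with `t` factors. -/
def descProd {A : Type*} [Ring A] (T : ℕ → A) (N : ℕ) : ℕ → A
  | 0 => 1
  | t + 1 => descProd T N t * T (N - t)

/-- The subalgebra generated by the `T_i` with `1 ≤ i < N`. -/
def heckeBelow (R : Type*) {A : Type*} [CommRing R] [Ring A] [Algebra R A] (T : ℕ → A) (N : ℕ) :
    Subalgebra R A :=
  Algebra.adjoin R {x | ∃ i, 1 ≤ i ∧ i < N ∧ x = T i}

theorem descProd_commute {A : Type*} [Ring A] {T : ℕ → A} {N : ℕ} {z : A} (t : ℕ)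
    (h : ∀ i, N < i + t → i ≤ N → Commute (T i) z) (ht : t ≤ N) :
    Commute (descProd T N t) z := by
  induction t with
  | zero => exact Commute.one_left z
  | succ t ih =>
    exact (ih (fun i h1 h2 => h i (by omega) h2) (by omega)).mul_left
      (h _ (by omega) (by omega))

section Affine

variable {R A : Type*} [CommRing R] [Ring A] [Algebra R A] {q : Rˣ} {r : ℕ} {T : ℕ → A}

theorem mem_heckeBelow {N i : ℕ} (h1 : 1 ≤ i) (h2 : i < N) : T i ∈ heckeBelow R T N :=
  Algebra.subset_adjoin ⟨i, h1, h2, rfl⟩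

theorem heckeBelow_commute {N : ℕ} {z h : A} (hz : ∀ i, 1 ≤ i → i < N → Commute (T i) z)
    (hh : h ∈ heckeBelow R T N) : Commute h z := by
  induction hh using Algebra.adjoin_induction with
  | mem x hx => obtain ⟨i, h1, h2, rfl⟩ := hx; exact hz i h1 h2
  | algebraMap c => exact Algebra.commutes c z
  | add x y _ _ hx hy => exact hx.add_left hy
  | mul x y _ _ hx hy => exact hx.mul_left hy

namespace AffineHeckeRel

variable (H : AffineHeckeRel q r T)
include H

/-! ### Coset decomposition of the type `A` Hecke algebra -/

/-- The hypotheses put both `T_j` and `T_{j-1}` in the descending product, so one braid move carries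
the new factor through it. -/
theorem descProd_mul_shift {N t j : ℕ} (ht : t ≤ N) (hj : N + 2 ≤ j + t) (hjN : j ≤ N) :
    descProd T N t * T j = T (j - 1) * descProd T N t := by
  induction t with
  | zero => omega
  | succ t ih =>
    rcases Nat.lt_or_ge (N + 1) (j + t) with h | h
    · have hc : Commute (T (N - t)) (T j) := H.far_comm _ _ (by omega)
      rw [descProd, mul_assoc, hc.eq, ← mul_assoc, ih (by omega) (by omega), mul_assoc]
    · obtain ⟨s, rfl⟩ : ∃ s, t = s + 1 := ⟨t - 1, by omega⟩
      obtain ⟨k, rfl⟩ : ∃ k, j = k + 1 := ⟨j - 1, by omega⟩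
      have e1 : N - (s + 1) = k := by omega
      have e2 : N - s = k + 1 := by omega
      have hc : Commute (descProd T N s) (T k) :=
        descProd_commute s (fun i h1 h2 => (H.far_comm k i (by omega)).symm) (by omega)
      simp only [descProd, e1, e2, Nat.add_sub_cancel]
      calc descProd T N s * T (k + 1) * T k * T (k + 1)
          = descProd T N s * (T (k + 1) * T k * T (k + 1)) := by simp only [mul_assoc]
        _ = (descProd T N s * T k) * T (k + 1) * T k := by
            rw [← H.braid k (by omega)]; simp only [mul_assoc]
        _ = _ := by rw [hc.eq]; simp only [mul_assoc]

/-- The span contains `1` and is stable under right multiplication by each `T_j`. The cases compare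
`j` with `N - t`: below, `T_j` commutes into `x`; equal, the product lengthens; one above, the
quadratic relation applies; higher, the braid shift does. -/
theorem heckeBelow_succ_le_span {N : ℕ} (hN : N < r) {h : A} (hh : h ∈ heckeBelow R T (N + 1)) :
    h ∈ Submodule.span R
      {y | ∃ x ∈ heckeBelow R T N, ∃ t ≤ N, y = x * descProd T N t} := by
  set S := {y | ∃ x ∈ heckeBelow R T N, ∃ t ≤ N, y = x * descProd T N t} with hS
  have key : ∀ j, 1 ≤ j → j < N + 1 → ∀ y ∈ S, y * T j ∈ Submodule.span R S := by
    rintro j hj hjN y ⟨x, hx, t, ht, rfl⟩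
    rw [mul_assoc]
    rcases Nat.lt_or_ge (j + t) N with h1 | h1
    · have hc : Commute (descProd T N t) (T j) :=
        descProd_commute t (fun i h2 h3 => (H.far_comm j i (by omega)).symm) ht
      rw [hc.eq, ← mul_assoc]
      exact Submodule.subset_span ⟨_, mul_mem hx (mem_heckeBelow hj (by omega)), t, ht, rfl⟩
    rcases h1.eq_or_lt with h2 | h2
    · have : descProd T N t * T j = descProd T N (t + 1) := by
        rw [descProd, show N - t = j by omega]
      rw [this]
      exact Submodule.subset_span ⟨x, hx, t + 1, by omega, rfl⟩
    rcases Nat.lt_or_ge (N + 1) (j + t) with h3 | h3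
    · rw [H.descProd_mul_shift ht (by omega) (by omega), ← mul_assoc]
      exact Submodule.subset_span
        ⟨_, mul_mem hx (mem_heckeBelow (by omega) (by omega)), t, ht, rfl⟩
    · obtain ⟨s, rfl⟩ : ∃ s, t = s + 1 := ⟨t - 1, by omega⟩
      have : x * (descProd T N (s + 1) * T j) =
          ((q : R) - 1) • (x * descProd T N (s + 1)) + (q : R) • (x * descProd T N s) := by
        rw [descProd, show N - s = j by omega, mul_assoc (descProd T N s),
          H.quadratic j hj (by omega)]
        simp only [mul_add, mul_smul_comm, mul_one]
      rw [this]
      exact add_mem (Submodule.smul_mem _ _ (Submodule.subset_span ⟨x, hx, _, ht, rfl⟩))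
        (Submodule.smul_mem _ _ (Submodule.subset_span ⟨x, hx, s, by omega, rfl⟩))
  have key2 : ∀ j, 1 ≤ j → j < N + 1 → ∀ y ∈ Submodule.span R S,
      y * T j ∈ Submodule.span R S := by
    intro j hj hjN y hy
    induction hy using Submodule.span_induction with
    | mem y hy => exact key j hj hjN y hy
    | zero => rw [zero_mul]; exact zero_mem _
    | add x y _ _ hx hy => rw [add_mul]; exact add_mem hx hy
    | smul c x _ hx => rw [smul_mul_assoc]; exact Submodule.smul_mem _ _ hx
  have key3 : ∀ y ∈ Submodule.span R S, y * h ∈ Submodule.span R S := by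
    induction hh using Algebra.adjoin_induction with
    | mem x hx => obtain ⟨i, h1, h2, rfl⟩ := hx; exact key2 i h1 h2
    | algebraMap c =>
      intro y hy
      rw [← Algebra.commutes, ← Algebra.smul_def]
      exact Submodule.smul_mem _ _ hy
    | add x y _ _ hx hy =>
      intro z hz; rw [mul_add]; exact add_mem (hx z hz) (hy z hz)
    | mul x y _ _ hx hy =>
      intro z hz; rw [← mul_assoc]; exact hy _ (hx z hz)
  have := key3 1 (Submodule.subset_span ⟨1, one_mem _, 0, Nat.zero_le _, by simp [descProd]⟩)
  rwa [one_mul] at this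

/-! ### The vanishing induction -/

theorem mul_heckeBelow_mul_eq_zero {X Y Z : ℕ → A}
    (hX : ∀ i c, 1 ≤ i → i < r → i ≠ c → Commute (T i) (X c))
    (hY : ∀ i c, 1 ≤ i → i < r → i ≠ c → Commute (T i) (Y c))
    (hYZ : ∀ d, Y (d + 1) = Y d * Z d)
    (hXY : ∀ c d, 1 ≤ c → 1 ≤ d → X c * Y d = 0)
    (N : ℕ) (hN : N ≤ r) (c d : ℕ) (hc : c ≤ N) (hd : d ≤ N) (hcd : N < c + d)
    (h : A) (hh : h ∈ heckeBelow R T N) : X c * h * Y d = 0 := by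
  induction N generalizing c d h with
  | zero => omega
  | succ N ih =>
    rcases hc.eq_or_lt with rfl | hc
    · have := heckeBelow_commute (z := X (N + 1))
        (fun i h1 h2 => hX i _ h1 (by omega) (by omega)) hh
      rw [← this.eq, mul_assoc, hXY _ _ (by omega) (by omega), mul_zero]
    rcases hd.eq_or_lt with rfl | hd
    · have := heckeBelow_commute (z := Y (N + 1))
        (fun i h1 h2 => hY i _ h1 (by omega) (by omega)) hh
      rw [mul_assoc, this.eq, ← mul_assoc, hXY _ _ (by omega) (by omega), zero_mul]
    obtain ⟨e, rfl⟩ : ∃ e, d = e + 1 := ⟨d - 1, by omega⟩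
    -- A last factor of index at most `e` commutes with `Y (e + 1)` and can be stripped off; if all
    -- indices exceed `e`, the whole product commutes with `Y e`.
    have hdesc : ∀ t ≤ N, ∃ z, descProd T N t * Y (e + 1) = Y e * z := by
      intro t
      induction t with
      | zero => intro _; exact ⟨Z e, by rw [descProd, one_mul, hYZ]⟩
      | succ t iht =>
        intro ht
        rcases Nat.lt_or_ge (N - t) (e + 1) with h1 | h1
        · obtain ⟨z, hz⟩ := iht (by omega)
          refine ⟨z * T (N - t), ?_⟩
          rw [descProd, mul_assoc, (hY (N - t) (e + 1) (by omega) (by omega) (by omega)).eq,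
            ← mul_assoc, hz, mul_assoc]
        · refine ⟨descProd T N (t + 1) * Z e, ?_⟩
          have : Commute (descProd T N (t + 1)) (Y e) :=
            descProd_commute _ (fun i h2 h3 => hY i e (by omega) (by omega) (by omega)) ht
          rw [hYZ, ← mul_assoc, this.eq, mul_assoc]
    have hspan := H.heckeBelow_succ_le_span (by omega) hh
    clear hh
    induction hspan using Submodule.span_induction with
    | mem y hy =>
      obtain ⟨x, hx, t, ht, rfl⟩ := hy
      obtain ⟨z, hz⟩ := hdesc t ht
      rw [← mul_assoc, mul_assoc _ (descProd T N t), hz, ← mul_assoc,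
        ih (by omega) c e (by omega) (by omega) (by omega) x hx, zero_mul]
    | zero => rw [mul_zero, zero_mul]
    | add x y _ _ hx hy => rw [mul_add, add_mul, hx, hy, add_zero]
    | smul a x _ hx => rw [mul_smul_comm, smul_mul_assoc, hx, smul_zero]

/-! ### Commutation of the Jucys–Murphy elements -/

theorem commute_jucysMurphy_of_lt {i j : ℕ} (hij : j + 1 < i) :
    Commute (T i) (jucysMurphy q T j) := by
  induction j with
  | zero => exact (H.far_comm 0 i (by omega)).symm
  | succ j ih =>
    have h1 : Commute (T i) (T (j + 1)) := (H.far_comm (j + 1) i (by omega)).symm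
    exact ((h1.mul_right (ih (by omega))).mul_right h1).smul_right _

theorem commute_jucysMurphy_of_gt {i j : ℕ} (hi : 1 ≤ i) (hij : i < j) :
    Commute (T i) (jucysMurphy q T j) := by
  induction j, hij using Nat.le_induction with
  | base =>
    obtain ⟨k, rfl⟩ : ∃ k, i = k + 1 := ⟨i - 1, by omega⟩
    have hL : Commute (T (k + 1 + 1)) (jucysMurphy q T k) :=
      H.commute_jucysMurphy_of_lt (by omega)
    have hb := H.braid (k + 1) hi
    simp only [jucysMurphy, mul_smul_comm, smul_mul_assoc]
    refine Commute.smul_right (Commute.smul_right ?_ _) _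
    generalize T (k + 1) = s at *
    generalize T (k + 1 + 1) = t at *
    generalize jucysMurphy q T k = l at *
    change s * (t * (s * l * s) * t) = t * (s * l * s) * t * s
    calc s * (t * (s * l * s) * t) = (s * t * s) * l * s * t := by simp only [mul_assoc]
      _ = t * s * (t * l) * s * t := by rw [hb]; simp only [mul_assoc]
      _ = t * s * l * (t * s * t) := by rw [hL.eq]; simp only [mul_assoc]
      _ = _ := by rw [← hb]; simp only [mul_assoc]
  | succ j hj ih =>
    have h1 : Commute (T i) (T (j + 1)) := H.far_comm i (j + 1) (by omega)
    exact ((h1.mul_right ih).mul_right h1).smul_right _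

theorem jucysMurphy_commute_of_lt {i j : ℕ} (hij : i < j) :
    Commute (jucysMurphy q T i) (jucysMurphy q T j) := by
  induction i generalizing j with
  | zero =>
    induction j, hij using Nat.le_induction with
    | base =>
      refine Commute.smul_right ?_ _
      change T 0 * (T 1 * T 0 * T 1) = T 1 * T 0 * T 1 * T 0
      rw [← H.quartic]; simp only [mul_assoc]
    | succ j hj ih =>
      have h1 : Commute (T 0) (T (j + 1)) := H.far_comm 0 (j + 1) (by omega)
      exact ((h1.mul_right ih).mul_right h1).smul_right _
  | succ i ih =>
    have h1 : Commute (T (i + 1)) (jucysMurphy q T j) :=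
      H.commute_jucysMurphy_of_gt (by omega) hij
    exact ((h1.mul_left (ih (by omega))).mul_left h1).smul_left _

theorem jucysMurphy_commute (i j : ℕ) : Commute (jucysMurphy q T i) (jucysMurphy q T j) := by
  rcases lt_trichotomy i j with h | rfl | h
  · exact H.jucysMurphy_commute_of_lt h
  · exact Commute.refl _
  · exact (H.jucysMurphy_commute_of_lt h).symm

/-- The product is symmetric in the two neighbouring Jucys–Murphy elements, and `T (i + 1)` commutes
with their sum and product by the quadratic relation. -/
theorem commute_shifted_pair {i : ℕ} (hi : i + 1 < r) (x : R) :
    Commute (T (i + 1)) ((jucysMurphy q T i - algebraMap R A x) *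
      (jucysMurphy q T (i + 1) - algebraMap R A x)) := by
  have hL := H.jucysMurphy_commute i (i + 1)
  have hq := H.quadratic (i + 1) (by omega) hi
  have hM : (q : R) • jucysMurphy q T (i + 1) = T (i + 1) * jucysMurphy q T i * T (i + 1) := by
    rw [jucysMurphy, smul_smul, Units.mul_inv, one_smul]
  generalize jucysMurphy q T (i + 1) = M at *
  generalize jucysMurphy q T i = L at *
  generalize T (i + 1) = s at *
  have cancel : ∀ y z : A, (q : R) • y = (q : R) • z → y = z := fun y z h => by
    simpa [smul_smul] using congrArg (fun w => ((q⁻¹ : Rˣ) : R) • w) h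
  have h1 : s * M = ((q : R) - 1) • M + L * s := cancel _ _ <| by
    calc (q : R) • (s * M) = (s * s) * L * s := by
          rw [← mul_smul_comm, hM]; simp only [mul_assoc]
      _ = ((q : R) - 1) • (s * L * s) + (q : R) • (L * s) := by
          rw [hq]; simp only [add_mul, smul_mul_assoc, one_mul]
      _ = _ := by rw [← hM, smul_add, smul_comm]
  have h2 : M * s = ((q : R) - 1) • M + s * L := cancel _ _ <| by
    calc (q : R) • (M * s) = s * L * (s * s) := by
          rw [← smul_mul_assoc, hM]; simp only [mul_assoc]
      _ = ((q : R) - 1) • (s * L * s) + (q : R) • (s * L) := by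
          rw [hq]; simp only [mul_add, mul_smul_comm, mul_one]
      _ = _ := by rw [← hM, smul_add, smul_comm]
  have hadd : Commute s (L + M) := by
    change s * (L + M) = (L + M) * s
    rw [mul_add, add_mul, h1, h2]; abel
  have hmul : Commute s (L * M) := by
    refine cancel _ _ ?_
    calc (q : R) • (s * (L * M)) = (s * L * s) * L * s := by
          rw [← mul_smul_comm, ← mul_smul_comm, hM]; simp only [mul_assoc]
      _ = (q : R) • (L * M * s) := by rw [← hM, hL.eq]; simp only [smul_mul_assoc]
  have e : (L - algebraMap R A x) * (M - algebraMap R A x) =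
      L * M - algebraMap R A x * (L + M) + algebraMap R A (x * x) := by
    rw [sub_mul, mul_sub, mul_sub, ← Algebra.commutes x L, mul_add, map_mul]; abel
  rw [e]
  exact (hmul.sub_right ((Algebra.commute_algebraMap_right x s).mul_right hadd)).add_right
    (Algebra.commute_algebraMap_right _ s)

/-! ### Products of shifted Jucys–Murphy elements -/

section Lift

variable {C : Type*} [CommRing C] {φ : C →+* A} {l : ℕ → C} {κ : R → C}
  (hl : ∀ i, φ (l i) = jucysMurphy q T i) (hκ : ∀ x, φ (κ x) = algebraMap R A x)
include hl hκ

theorem commute_map_shiftedProd {i c : ℕ} (hi : 1 ≤ i) (hr : i < r) (hic : i ≠ c) (x : R) :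
    Commute (T i) (φ (∏ j ∈ Finset.range c, (l j - κ x))) := by
  have hterm : ∀ j, j + 1 < i ∨ i < j → Commute (T i) (φ (l j - κ x)) := by
    intro j hj
    rw [map_sub, hl, hκ]
    refine Commute.sub_right ?_ (Algebra.commute_algebraMap_right x _)
    rcases hj with hj | hj
    · exact H.commute_jucysMurphy_of_lt hj
    · exact H.commute_jucysMurphy_of_gt hi hj
  have hlow : ∀ c < i, Commute (T i) (φ (∏ j ∈ Finset.range c, (l j - κ x))) := by
    intro c
    induction c with
    | zero => intro _; simp
    | succ c ih =>
      intro hc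
      rw [Finset.prod_range_succ, map_mul]
      exact (ih (by omega)).mul_right (hterm c (Or.inl hc))
  rcases hic.lt_or_gt with h | h
  · induction c, h using Nat.le_induction with
    | base =>
      obtain ⟨k, rfl⟩ : ∃ k, i = k + 1 := ⟨i - 1, by omega⟩
      -- At `c = i + 1` the last two factors are the only ones not commuting with `T i`
      -- individually.
      rw [Finset.prod_range_succ, Finset.prod_range_succ, mul_assoc, map_mul, map_mul, map_sub,
        map_sub, hl, hl, hκ]
      exact (hlow k (by omega)).mul_right (H.commute_shifted_pair hr x)
    | succ c hc ih =>
      rw [Finset.prod_range_succ, map_mul]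
      exact (ih (by omega)).mul_right (hterm c (Or.inr hc))
  · exact hlow c h

theorem commute_map_prod_shiftedProd {i c : ℕ} (hi : 1 ≤ i) (hr : i < r) (hic : i ≠ c)
    (v : ℕ → R) (s : Finset ℕ) :
    Commute (T i) (φ (∏ n ∈ s, ∏ j ∈ Finset.range c, (l j - κ (v n)))) := by
  induction s using Finset.induction_on with
  | empty => simp
  | insert a s ha ih =>
    rw [Finset.prod_insert ha, map_mul]
    exact (H.commute_map_shiftedProd hl hκ hi hr hic _).mul_right ih

theorem map_mul_heckeBelow_mul_map_eq_zero {m k : ℕ} (hk : k ≤ m) (v : ℕ → R)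
    (hv : φ (∏ n ∈ Finset.range m, (l 0 - κ (v n))) = 0) {c d : ℕ} (hc : c ≤ r) (hd : d ≤ r)
    (hcd : r < c + d) {h : A} (hh : h ∈ heckeBelow R T r) :
    φ (∏ n ∈ Finset.Ico k m, ∏ j ∈ Finset.range c, (l j - κ (v n))) * h *
      φ (∏ n ∈ Finset.range k, ∏ j ∈ Finset.range d, (l j - κ (v n))) = 0 := by
  refine H.mul_heckeBelow_mul_eq_zero
    (X := fun c => φ (∏ n ∈ Finset.Ico k m, ∏ j ∈ Finset.range c, (l j - κ (v n))))
    (Y := fun d => φ (∏ n ∈ Finset.range k, ∏ j ∈ Finset.range d, (l j - κ (v n))))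
    (Z := fun d => φ (∏ n ∈ Finset.range k, (l d - κ (v n))))
    (fun i c h1 h2 h3 => H.commute_map_prod_shiftedProd hl hκ h1 h2 h3 _ _)
    (fun i c h1 h2 h3 => H.commute_map_prod_shiftedProd hl hκ h1 h2 h3 _ _)
    (fun d => ?_) (fun c d hc hd => ?_) r le_rfl c d hc hd hcd h hh
  · simp only [Finset.prod_range_succ, Finset.prod_mul_distrib, map_mul]
  -- The `j = 0` factors from both blocks together form the full cyclotomic product.
  · have hdvd : ∀ e, 1 ≤ e → ∀ s : Finset ℕ, ∏ n ∈ s, (l 0 - κ (v n)) ∣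
        ∏ n ∈ s, ∏ j ∈ Finset.range e, (l j - κ (v n)) := fun e he s =>
      Finset.prod_dvd_prod_of_dvd _ _ fun n _ =>
        Finset.dvd_prod_of_mem (fun j => l j - κ (v n)) (Finset.mem_range.mpr he)
    obtain ⟨z, hz⟩ := mul_dvd_mul (hdvd d hd (Finset.range k)) (hdvd c hc (Finset.Ico k m))
    change φ _ * φ _ = 0
    rw [← map_mul, mul_comm, hz, Finset.prod_range_mul_prod_Ico _ hk, map_mul, hv, zero_mul]

end Lift

end AffineHeckeRel

end Affine

/-- The Jucys–Murphy elements generate a commutative subalgebra; computing there makes `Finset`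
products, reordering and divisibility available. -/
theorem AffineHeckeRel.exists_commRing_lift.{v, w} {R : Type v} {A : Type w} [CommRing R] [Ring A]
    [Algebra R A] {q : Rˣ} {r : ℕ} {T : ℕ → A} (H : AffineHeckeRel q r T) :
    ∃ (C : Type w) (_ : CommRing C) (φ : C →+* A) (l : ℕ → C) (κ : R → C),
      (∀ i, φ (l i) = jucysMurphy q T i) ∧ ∀ x, φ (κ x) = algebraMap R A x := by
  have hc := Algebra.isMulCommutative_adjoin R (s := Set.range (jucysMurphy q T)) <| by
    rintro _ ⟨i, rfl⟩ _ ⟨j, rfl⟩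
    exact H.jucysMurphy_commute i j
  exact ⟨Algebra.adjoin R (Set.range (jucysMurphy q T)),
    { (inferInstance : Ring (Algebra.adjoin R (Set.range (jucysMurphy q T)))) with
      mul_comm := hc.is_comm.comm },
    (Algebra.adjoin R (Set.range (jucysMurphy q T))).val.toRingHom,
    fun i => ⟨_, Algebra.subset_adjoin ⟨i, rfl⟩⟩, fun x => algebraMap R _ x,
    fun _ => rfl, fun _ => rfl⟩

theorem mul_self_eq_of_quadratic {R A : Type*} [CommRing R] [Ring A] [Algebra R A] {q : R} {x : A}
    (h : (x - algebraMap R A q) * (x + 1) = 0) : x * x = (q - 1) • x + q • (1 : A) := by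
  rw [← sub_eq_zero, ← h, Algebra.algebraMap_eq_smul_one]
  simp only [sub_mul, mul_add, smul_mul_assoc, one_mul, mul_one, sub_smul, one_smul]
  abel

theorem map_prod_range_eq_prod_ofFn {C A : Type*} [CommRing C] [Ring A] (φ : C →+* A) (n : ℕ)
    (f : ℕ → C) : φ (∏ i ∈ Finset.range n, f i) = (List.ofFn fun i : Fin n => φ (f i)).prod := by
  rw [Finset.prod_range, ← List.prod_ofFn, map_list_prod, List.map_ofFn]
  rfl

/-! ### Application to the Ariki–Koike algebra -/

namespace ArikiKoike

variable {R : Type*} [CommRing R] {m : ℕ} (q : Rˣ) (u : Fin m → R) {r : ℕ}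

/-- The generators of the Ariki–Koike algebra, extended by zero. -/
noncomputable def genSeq (r : ℕ) (i : ℕ) : ArikiKoike q u r :=
  if h : i < r then T q u ⟨i, h⟩ else 0

theorem genSeq_of_lt {i : ℕ} (h : i < r) : genSeq q u r i = T q u ⟨i, h⟩ := dif_pos h

theorem genSeq_of_le {i : ℕ} (h : r ≤ i) : genSeq q u r i = 0 := dif_neg (by omega)

/-- Extension by zero preserves the braid and commutation relations but in general not the quadratic
one, hence its bound `i < r`. -/
theorem affineHeckeRel_genSeq (r : ℕ) : AffineHeckeRel q r (genSeq q u r) where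
  quartic := by
    rcases Nat.lt_or_ge 1 r with h | h
    · rw [genSeq_of_lt q u h, genSeq_of_lt q u (show 0 < r by omega)]
      simpa only [T, commute_iff_eq, map_mul] using RingQuot.mkAlgHom_rel R
        (ArikiKoikeRel.quartic (q := q) (u := u) ⟨0, by omega⟩ ⟨1, h⟩ rfl rfl)
    · simp [genSeq_of_le q u h]
  braid i hi := by
    rcases Nat.lt_or_ge (i + 1) r with h | h
    · rw [genSeq_of_lt q u h, genSeq_of_lt q u (show i < r by omega)]
      simpa only [T, commute_iff_eq, map_mul] using RingQuot.mkAlgHom_rel R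
        (ArikiKoikeRel.braid (q := q) (u := u) ⟨i, by omega⟩ ⟨i + 1, h⟩ hi rfl)
    · simp [genSeq_of_le q u h]
  far_comm i j hij := by
    rcases Nat.lt_or_ge j r with h | h
    · rw [genSeq_of_lt q u h, genSeq_of_lt q u (show i < r by omega)]
      simpa only [T, commute_iff_eq, map_mul] using RingQuot.mkAlgHom_rel R
        (ArikiKoikeRel.far_comm (q := q) (u := u) ⟨i, by omega⟩ ⟨j, h⟩ hij)
    · simp [genSeq_of_le q u h]
  quadratic i hi hr := by
    rw [genSeq_of_lt q u hr]
    refine mul_self_eq_of_quadratic ?_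
    simpa only [T, map_mul, map_sub, map_add, map_one, map_zero, AlgHom.commutes] using
      RingQuot.mkAlgHom_rel R
        (ArikiKoikeRel.quadratic (q := q) (u := u) ⟨i, hr⟩ (Nat.one_le_iff_ne_zero.mp hi))

theorem jucysMurphy_genSeq (i : ℕ) (hi : i < r) : jucysMurphy q (genSeq q u r) i = L q u i hi := by
  induction i with
  | zero => exact genSeq_of_lt q u hi
  | succ i ih => rw [jucysMurphy, L, ih, genSeq_of_lt q u hi]

theorem prod_genSeq_zero_sub (hr : 0 < r) :
    (List.ofFn fun k : Fin m => genSeq q u r 0 - algebraMap R _ (u k)).prod = 0 := by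
  rw [genSeq_of_lt q u hr]
  have := RingQuot.mkAlgHom_rel R (ArikiKoikeRel.cyclotomic (q := q) (u := u) ⟨0, hr⟩ rfl)
  simpa only [T, map_list_prod, List.map_ofFn, Function.comp_def, map_sub, map_zero,
    AlgHom.commutes] using this

theorem heckeA_le_heckeBelow : heckeA q u r ≤ heckeBelow R (genSeq q u r) r := by
  refine Algebra.adjoin_mono ?_
  rintro _ ⟨i, hi, rfl⟩
  exact ⟨i, hi, i.isLt, (genSeq_of_lt q u i.isLt).symm⟩

section Lift

variable {C : Type*} [CommRing C] {φ : C →+* ArikiKoike q u r} {l : ℕ → C} {κ : R → C}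
  (hl : ∀ i, φ (l i) = jucysMurphy q (genSeq q u r) i)
  (hκ : ∀ x, φ (κ x) = algebraMap R (ArikiKoike q u r) x)
include hl hκ

theorem piFactor_eq_map (c : ℕ) (hc : c ≤ r) (x : R) :
    piFactor q u c hc x = φ (∏ j ∈ Finset.range c, (l j - κ x)) := by
  rw [map_prod_range_eq_prod_ofFn, piFactor]
  congr 2
  funext j
  rw [map_sub, hl, hκ, jucysMurphy_genSeq q u j (by omega)]

theorem piSeq_eq_map (a : CompChain m r) (x : Fin (m - 1) → R) (α : ℕ → ℕ) (y : ℕ → R)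
    (hα : ∀ k (hk : k < m - 1), α k = a.seq ⟨k + 1, by omega⟩)
    (hy : ∀ k (hk : k < m - 1), y k = x ⟨k, hk⟩) :
    piSeq q u a x =
      φ (∏ k ∈ Finset.range (m - 1), ∏ j ∈ Finset.range (α k), (l j - κ (y k))) := by
  rw [map_prod_range_eq_prod_ofFn, piSeq]
  congr 2
  funext k
  rw [piFactor_eq_map q u hl hκ, hα k k.isLt, hy k k.isLt]

end Lift

/-- A general `v` allows both orders of the parameters. For `r = 0` the zero extension need not
satisfy `hv`, hence its guard. -/
theorem piSeq_mul_mul_piSeq_dual_eq_zero (a b : CompChain m r) (hab : ¬ a ≤ b) (v : Fin m → R)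
    (hv : 0 < r → (List.ofFn fun k : Fin m => genSeq q u r 0 - algebraMap R _ (v k)).prod = 0)
    {h : ArikiKoike q u r} (hh : h ∈ heckeA q u r) :
    piSeq q u a (fun k => v ⟨(k : ℕ) + 1, by omega⟩) * h *
      piSeq q u b.dual (fun k => v ⟨m - 2 - (k : ℕ), by omega⟩) = 0 := by
  obtain ⟨⟨i, hi⟩, hlt⟩ : ∃ i, b.seq i < a.seq i := by
    by_contra! hc
    exact hab hc
  have hi0 : i ≠ 0 := by
    rintro rfl
    exact absurd (a.seq_zero ▸ hlt) (Nat.not_lt_zero _)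
  have him : i ≠ m := by
    rintro rfl
    have h1 := a.seq_last
    have h2 := b.seq_last
    simp only [Fin.last] at h1 h2
    omega
  have har := a.seq_le ⟨i, hi⟩
  have H := affineHeckeRel_genSeq q u r
  obtain ⟨C, _, φ, l, κ, hl, hκ⟩ := H.exists_commRing_lift
  let w : ℕ → R := fun n => if hn : n < m then v ⟨n, hn⟩ else 0
  let α : ℕ → ℕ := fun n => if hn : n < m + 1 then a.seq ⟨n, hn⟩ else 0
  let β : ℕ → ℕ := fun n => if hn : n < m + 1 then r - b.seq ⟨n, hn⟩ else 0
  have hα : ∀ n (hn : n < m + 1), α n = a.seq ⟨n, hn⟩ := fun n hn => dif_pos hn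
  have hβ : ∀ n (hn : n < m + 1), β n = r - b.seq ⟨n, hn⟩ := fun n hn => dif_pos hn
  have hw : ∀ n (hn : n < m), w n = v ⟨n, hn⟩ := fun n hn => dif_pos hn
  let P : ℕ → ℕ → C := fun c n => ∏ j ∈ Finset.range c, (l j - κ (w n))
  have hP : ∀ {c d : ℕ} (n : ℕ), c ≤ d → P c n ∣ P d n := fun n hcd =>
    Finset.prod_dvd_prod_of_subset _ _ _ (Finset.range_subset_range.mpr hcd)
  have ea : piSeq q u a (fun k => v ⟨(k : ℕ) + 1, by omega⟩) =
      φ (∏ n ∈ Finset.Ico 1 m, P (α n) n) := by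
    rw [Finset.prod_Ico_eq_prod_range]
    simp only [add_comm 1]
    exact piSeq_eq_map q u hl hκ a _ (fun k => α (k + 1)) (fun k => w (k + 1))
      (fun k hk => hα _ _) (fun k hk => hw _ _)
  -- After reversal the parameter `v n` carries the exponent `r - b_{n+1}`, whereas in `ea` it
  -- carries `a_n`.
  have eb : piSeq q u b.dual (fun k => v ⟨m - 2 - (k : ℕ), by omega⟩) =
      φ (∏ n ∈ Finset.range (m - 1), P (β (n + 1)) n) := by
    rw [← Finset.prod_range_reflect]
    refine piSeq_eq_map q u hl hκ b.dual _ (fun k => β (m - 1 - 1 - k + 1))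
      (fun k => w (m - 1 - 1 - k)) (fun k hk => ?_) (fun k hk => ?_)
    · rw [hβ _ (by omega)]
      simp only [CompChain.dual]
      congr 2
      ext
      simp only [Fin.val_rev]
      omega
    · exact hw _ _
  have da : ∏ n ∈ Finset.Ico i m, P (a.seq ⟨i, hi⟩) n ∣ ∏ n ∈ Finset.Ico 1 m, P (α n) n := by
    refine (Finset.prod_dvd_prod_of_dvd _ _ fun n hn => hP n ?_).trans
      (Finset.prod_dvd_prod_of_subset _ _ (fun n => P (α n) n)
        (Finset.Ico_subset_Ico_left (by omega)))
    rw [Finset.mem_Ico] at hn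
    rw [hα n (by omega)]
    exact a.seq_mono hn.1
  have db : ∏ n ∈ Finset.range i, P (r - b.seq ⟨i, hi⟩) n ∣
      ∏ n ∈ Finset.range (m - 1), P (β (n + 1)) n := by
    refine (Finset.prod_dvd_prod_of_dvd _ _ fun n hn => hP n ?_).trans
      (Finset.prod_dvd_prod_of_subset _ _ (fun n => P (β (n + 1)) n)
        (Finset.range_subset_range.mpr (by omega)))
    rw [Finset.mem_range] at hn
    rw [hβ _ (by omega)]
    exact Nat.sub_le_sub_left (b.seq_mono (show n + 1 ≤ i by omega)) r
  have hcyc : φ (∏ n ∈ Finset.range m, (l 0 - κ (w n))) = 0 := by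
    rw [map_prod_range_eq_prod_ofFn, ← hv (by omega)]
    congr 2
    funext k
    rw [map_sub, hl, hκ, hw k k.isLt]
    rfl
  have hzero := H.map_mul_heckeBelow_mul_map_eq_zero hl hκ (show i ≤ m by omega) w hcyc har
    (Nat.sub_le r (b.seq ⟨i, hi⟩)) (by omega) (heckeA_le_heckeBelow q u hh)
  obtain ⟨y, hy⟩ := da
  obtain ⟨z, hz⟩ := db
  rw [ea, eb, hy, hz, mul_comm _ y, map_mul, map_mul]
  calc _ = φ y * (φ (∏ n ∈ Finset.Ico i m, P (a.seq ⟨i, hi⟩) n) * h *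
        φ (∏ n ∈ Finset.range i, P (r - b.seq ⟨i, hi⟩) n)) * φ z := by simp only [mul_assoc]
    _ = 0 := by rw [hzero, mul_zero, zero_mul]

end ArikiKoike

theorem mainTheorem10 {R : Type*} [CommRing R] {m r : ℕ} (hm : 0 < m)
    (q : Rˣ) (u : Fin m → R) (a b : CompChain m r) (hab : ¬ a ≤ b) :
    (∀ h ∈ ArikiKoike.heckeA q u r,
        ArikiKoike.piElt q u a * h * ArikiKoike.piTilde q u b.dual = 0) ∧
      (∀ h ∈ ArikiKoike.heckeA q u r,
        ArikiKoike.piTilde q u a * h * ArikiKoike.piElt q u b.dual = 0) := by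
  refine ⟨fun h hh => ArikiKoike.piSeq_mul_mul_piSeq_dual_eq_zero q u a b hab u
    (ArikiKoike.prod_genSeq_zero_sub q u) hh, fun h hh => ?_⟩
  -- The cyclotomic factors commute, so the relation survives reversing the parameters.
  have hv : 0 < r → (List.ofFn fun k : Fin m =>
      ArikiKoike.genSeq q u r 0 - algebraMap R _ (u k.rev)).prod = 0 := by
    intro hr
    have H := ArikiKoike.affineHeckeRel_genSeq q u r
    obtain ⟨C, _, φ, l, κ, hl, hκ⟩ := H.exists_commRing_lift
    have key : ∀ v : Fin m → R, (List.ofFn fun k : Fin m =>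
        ArikiKoike.genSeq q u r 0 - algebraMap R _ (v k)).prod = φ (∏ k, (l 0 - κ (v k))) := by
      intro v
      rw [← List.prod_ofFn, map_list_prod, List.map_ofFn]
      simp only [Function.comp_def, map_sub, hl, hκ]
      rfl
    have e : ∏ k : Fin m, (l 0 - κ (u k.rev)) = ∏ k, (l 0 - κ (u k)) :=
      Equiv.prod_comp Fin.revPerm (fun k => l 0 - κ (u k))
    rw [key (fun k => u k.rev), e, ← key, ArikiKoike.prod_genSeq_zero_sub q u hr]
  have := ArikiKoike.piSeq_mul_mul_piSeq_dual_eq_zero q u a b hab (fun k => u k.rev) hv hh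
  convert this using 3
  · unfold ArikiKoike.piTilde
    congr 1
    funext k
    congr 1
    ext
    simp only [Fin.val_rev]
    omega
  · unfold ArikiKoike.piElt
    congr 1
    funext k
    congr 1
    ext
    simp only [Fin.val_rev]
    omega
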